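/- Let $(X,d)$ be a perfect Polish metric space, i.e. a complete separable metric space without isolated points, and let $\mathcal K(X)$ be the space of nonempty compact subsets of $X$ with the Hausdorff metric. For a metric space $Y$ let $\ell_\infty(Y)$ be the space of bounded sequences in $Y$ with the supremum metric. For $A\in\mathcal K(X)$, a GIFS$_\infty$ on $\ell_\infty(A)$ is a finite family of maps $f_1,\dots,f_n:\ell_\infty(A)\to X$ with $\operatorname{Lip}(f_i)<1$ such that, for every bounded sequence $(K_k)$ in $\mathcal K(A)$, the closure $\overline{f_i\left(\prod_{k=1}^\infty K_k\right)}$ is a nonempty compact set (condition (C1)). It witnesses that $A$ is a generalized fractal if $$A=\bigcup_{i=1}^n\overline{f_i(A\times A\times\cdots)},$$ and $A$ is a generalized fractal if such a family exists. Then a typical $K\in\mathcal K(X)$ (i.e. all $K$ outside a meager subset of $\mathcal K(X)$) is a generalized fractal and, moreover, for every $r\in(0,1)$ there is a GIFS$_\infty$ $\mathcal F$ on $\ell_\infty(K)$ witnessing this with $\operatorname{Lip}(f)\le r$ for all $f\in\mathcal F$. -/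

import Mathlib

open Set Filter Topology TopologicalSpace
open scoped NNReal BoundedContinuousFunction

namespace GenFractal

/-- The space `ℓ_∞(X)` of all bounded sequences in a metric space `X`, with the supremum metric
(`ℕ` is discrete, so continuity of a sequence is no restriction). -/
abbrev EllInfty (X : Type*) [PseudoMetricSpace X] : Type _ := ℕ →ᵇ X

/-- `Lip(f) < 1`. -/
def IsContraction {Y X : Type*} [PseudoMetricSpace Y] [PseudoMetricSpace X] (f : Y → X) : Prop :=
  ∃ c : ℝ≥0, c < 1 ∧ LipschitzWith c f

/-- The product `∏ₖ Kₖ ⊆ ℓ_∞(Y)` of a bounded (for the Hausdorff metric) sequence of nonempty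
compact subsets of `Y`. -/
def compactProd {Y : Type*} [MetricSpace Y] (K : EllInfty (NonemptyCompacts Y)) :
    Set (EllInfty Y) :=
  {x | ∀ k, x k ∈ K k}

/-- Condition (C1): for every `(Kₖ) ∈ ℓ_∞(𝒦(Y))`, the closure of the image of the product
`∏ₖ Kₖ` is a nonempty compact set. -/
def ConditionC1 {Y X : Type*} [MetricSpace Y] [MetricSpace X] (f : EllInfty Y → X) : Prop :=
  ∀ K : EllInfty (NonemptyCompacts Y),
    (closure (f '' compactProd K)).Nonempty ∧ IsCompact (closure (f '' compactProd K))

/-- A finite family of contractions `ℓ_∞(Y) → X`, each satisfying (C1): a generalized iterated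
function system of infinite order, defined on `ℓ_∞(Y)`. -/
structure IsGIFSInfty {Y X : Type*} [MetricSpace Y] [MetricSpace X] {n : ℕ}
    (f : Fin n → EllInfty Y → X) : Prop where
  contraction : ∀ i, IsContraction (f i)
  conditionC1 : ∀ i, ConditionC1 (f i)

/-- The family `f` on `ℓ_∞(A)` is a GIFS of infinite order with `A = ⋃ᵢ closure (fᵢ(A × A × ⋯))`.
As `A` is bounded, `A × A × ⋯` is all of `ℓ_∞(A)`. -/
structure Witnesses {X : Type*} [MetricSpace X] (A : NonemptyCompacts X) {n : ℕ}
    (f : Fin n → EllInfty A → X) : Prop where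
  isGIFSInfty : IsGIFSInfty f
  eq_iUnion_closure : (A : Set X) = ⋃ i, closure (Set.range (f i))

/-- `A` is a generalized fractal. -/
def IsGeneralizedFractal {X : Type*} [MetricSpace X] (A : NonemptyCompacts X) : Prop :=
  ∃ (n : ℕ) (f : Fin n → EllInfty A → X), Witnesses A f

end GenFractal

/-!
Every disconnected compact set is a generalized fractal, and the disconnected sets form a dense
open subset of the hyperspace of a perfect metric space.

Let `A` be compact and disconnected. A continuous nonconstant function `A → Bool` is uniformly
continuous, so for some `δ > 0` points with different values are at distance at least `δ`. Apply it
coordinatewise to a sequence in `A` and take the position of the first value `true`: this gives a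
map `ℓ_∞(A) → ℕ` which is onto and takes different values only at sequences at distance at least
`δ` (`exists_surjective_nat_separated`). Hence its composition with *any* sequence in a set of
diameter at most `r δ` is `r`-Lipschitz. Cover `A` by finitely many sets of such small diameter,
and use a dense sequence in each of them: the closures of the images cover `A`. Condition (C1) is
automatic for maps with values in a compact set (`conditionC1_of_range_subset`).

Disconnectedness is an open condition on the compact set because two disjoint closed sets have
disjoint neighbourhoods (`isOpen_setOf_not_isPreconnected`). It is a dense condition because the
finite sets are dense in the hyperspace, and in a space without isolated points a finite set can be
enlarged, by an arbitrarily small change, to have at least two points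
(`dense_setOf_not_isPreconnected`).
-/

namespace GenFractal

/-! ### Disconnected compact sets are generalized fractals -/

theorem compactProd_nonempty {Y : Type*} [MetricSpace Y] [CompactSpace Y]
    (K : EllInfty (NonemptyCompacts Y)) : (compactProd K).Nonempty := by
  choose x hx using fun k => (K k).nonempty
  exact ⟨BoundedContinuousFunction.mkOfDiscrete x (Metric.diam (univ : Set Y)) fun _ _ =>
    Metric.dist_le_diam_of_mem isCompact_univ.isBounded (mem_univ _) (mem_univ _), hx⟩

theorem conditionC1_of_range_subset {Y X : Type*} [MetricSpace Y] [CompactSpace Y] [MetricSpace X]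
    {f : EllInfty Y → X} {A : Set X} (hA : IsCompact A) (hf : range f ⊆ A) : ConditionC1 f :=
  fun K => ⟨((compactProd_nonempty K).image f).closure,
    hA.closure_of_subset ((image_subset_range _ _).trans hf)⟩

/-- The infinite product of a disconnected compact space with itself, with the supremum metric,
splits into countably many nonempty pieces with a uniform gap between them. -/
theorem exists_surjective_nat_separated {Y : Type*} [MetricSpace Y] [CompactSpace Y]
    (hY : ¬ PreconnectedSpace Y) :
    ∃ δ > 0, ∃ N : EllInfty Y → ℕ, Function.Surjective N ∧
      ∀ x y, N x ≠ N y → δ ≤ dist x y := by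
  classical
  obtain ⟨S, hS, hS₀, hS₁⟩ : ∃ S : Set Y, IsClopen S ∧ S ≠ ∅ ∧ S ≠ univ := by
    rw [preconnectedSpace_iff_clopen] at hY
    push Not at hY
    simpa [nonempty_iff_ne_empty] using hY
  obtain ⟨a, ha⟩ := nonempty_iff_ne_empty.2 hS₀
  obtain ⟨b, hb⟩ := (ne_univ_iff_exists_notMem S).1 hS₁
  obtain ⟨δ, hδ, hsep⟩ : ∃ δ > 0, ∀ p q : Y, dist p q < δ → (p ∈ S ↔ q ∈ S) := by
    have hg : Continuous (S.boolIndicator) := (continuous_boolIndicator_iff_isClopen S).2 hS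
    obtain ⟨δ, hδ, h⟩ := Metric.mem_uniformity_dist.1
      (CompactSpace.uniformContinuous_of_continuous hg
        (DiscreteUniformity.relId_mem_uniformity Bool))
    refine ⟨δ, hδ, fun p q hpq => ?_⟩
    have hpq : S.boolIndicator p = S.boolIndicator q := h hpq
    rw [mem_iff_boolIndicator, mem_iff_boolIndicator, hpq]
  -- If no term lies in `S`, the index is the junk value `sInf ∅ = 0`; this is harmless, since the
  -- set of indices is still determined by the coordinatewise values.
  refine ⟨δ, hδ, fun x => sInf {k | x k ∈ S}, fun j => ?_, fun x y hxy => ?_⟩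
  · refine ⟨BoundedContinuousFunction.mkOfDiscrete (fun k => if k = j then a else b)
      (Metric.diam (univ : Set Y)) fun _ _ =>
        Metric.dist_le_diam_of_mem isCompact_univ.isBounded (mem_univ _) (mem_univ _), ?_⟩
    have : {k | (if k = j then a else b) ∈ S} = {j} := by
      ext k
      by_cases hk : k = j <;> simp [hk, ha, hb]
    simp [this]
  · by_contra! hlt
    refine hxy (congrArg sInf ?_)
    ext k
    exact hsep _ _ ((BoundedContinuousFunction.dist_coe_le_dist k).trans_lt hlt)

/-- Every disconnected compact set is a generalized fractal, with witnesses of arbitrarily small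
Lipschitz constant. -/
theorem exists_witnesses_lipschitzWith {X : Type*} [MetricSpace X] (A : NonemptyCompacts X)
    (hA : ¬ IsPreconnected (A : Set X)) {r : ℝ} (hr₀ : 0 < r) (hr₁ : r < 1) :
    ∃ (n : ℕ) (f : Fin n → EllInfty A → X),
      Witnesses A f ∧ ∀ i, LipschitzWith r.toNNReal (f i) := by
  have : CompactSpace A := isCompact_iff_compactSpace.1 A.isCompact
  obtain ⟨δ, hδ, N, hN, hsep⟩ := exists_surjective_nat_separated
    (fun h => hA (isPreconnected_iff_preconnectedSpace.2 h) : ¬ PreconnectedSpace A)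
  -- Balls of radius `r δ / 2` have diameter at most `r δ`, so every function of the index `N x`
  -- with values in such a ball is `r`-Lipschitz.
  have hε : 0 < r * δ / 2 := by positivity
  obtain ⟨t, -, ht, hcov⟩ := (isCompact_univ : IsCompact (univ : Set A)).finite_cover_balls hε
  obtain ⟨n, c, -, rfl⟩ := ht.fin_param
  have hne (i : Fin n) : Nonempty (Metric.ball (c i) (r * δ / 2)) :=
    ⟨⟨c i, Metric.mem_ball_self hε⟩⟩
  let f (i : Fin n) (x : EllInfty A) : X :=
    ((denseSeq (Metric.ball (c i) (r * δ / 2)) (N x) : A) : X)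
  have hfA (i : Fin n) : range (f i) ⊆ A := by
    rintro _ ⟨x, rfl⟩
    exact Subtype.coe_prop _
  have hlip (i : Fin n) : LipschitzWith r.toNNReal (f i) := by
    refine LipschitzWith.of_dist_le_mul fun x y => ?_
    rw [Real.coe_toNNReal _ hr₀.le]
    by_cases hxy : N x = N y
    · simp only [f, hxy, dist_self]
      positivity
    · have hx := (denseSeq (Metric.ball (c i) (r * δ / 2)) (N x)).2
      have hy := (denseSeq (Metric.ball (c i) (r * δ / 2)) (N y)).2
      have h := dist_triangle_right (denseSeq (Metric.ball (c i) (r * δ / 2)) (N x) : A)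
        (denseSeq (Metric.ball (c i) (r * δ / 2)) (N y) : A) (c i)
      rw [Metric.mem_ball] at hx hy
      calc dist (f i x) (f i y) ≤ r * δ := by
            change dist (denseSeq (Metric.ball (c i) (r * δ / 2)) (N x) : A)
              (denseSeq (Metric.ball (c i) (r * δ / 2)) (N y) : A) ≤ _
            linarith
        _ ≤ r * dist x y := by gcongr; exact hsep x y hxy
  refine ⟨n, f, ⟨⟨fun i => ⟨_, Real.toNNReal_lt_one.2 hr₁, hlip i⟩,
    fun i => conditionC1_of_range_subset A.isCompact (hfA i)⟩, ?_⟩, hlip⟩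
  refine Subset.antisymm (fun x hx => ?_)
    (iUnion_subset fun i => closure_minimal (hfA i) A.isCompact.isClosed)
  obtain ⟨_, ⟨i, rfl⟩, hi⟩ := mem_iUnion₂.1 (hcov (mem_univ (⟨x, hx⟩ : A)))
  have hcont : Continuous fun p : Metric.ball (c i) (r * δ / 2) => ((p : A) : X) := by fun_prop
  have hrange : range (f i) = (fun p : Metric.ball (c i) (r * δ / 2) => ((p : A) : X)) ''
      range (denseSeq _) := by
    rw [← range_comp, ← hN.range_comp]
    rfl
  refine mem_iUnion.2 ⟨i, ?_⟩
  rw [hrange]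
  exact image_closure_subset_closure_image hcont
    ⟨⟨⟨x, hx⟩, hi⟩, denseRange_denseSeq _ _, rfl⟩

/-! ### Genericity of disconnected compact sets -/

theorem isOpen_setOf_not_isPreconnected {X : Type*} [TopologicalSpace X] [T2Space X]
    [NormalSpace X] : IsOpen {K : NonemptyCompacts X | ¬ IsPreconnected (K : Set X)} := by
  refine isOpen_iff_forall_mem_open.2 fun K hK => ?_
  rw [mem_ofPred_eq,
    isPreconnected_iff_subset_of_fully_disjoint_closed K.isCompact.isClosed] at hK
  push Not at hK
  obtain ⟨u, v, hu, hv, huv, hd, hKu, hKv⟩ := hK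
  obtain ⟨U, V, hU, hV, huU, hvV, hUV⟩ := normal_separation hu hv hd
  refine ⟨{L | (L : Set X) ⊆ U ∪ V} ∩ {L | ((L : Set X) ∩ U).Nonempty} ∩
      {L | ((L : Set X) ∩ V).Nonempty}, ?_, ?_, ?_⟩
  · rintro L ⟨⟨hL, hLU⟩, hLV⟩ hpre
    obtain ⟨x, -, hx⟩ := hpre U V hU hV hL hLU hLV
    exact disjoint_left.1 hUV hx.1 hx.2
  · exact ((NonemptyCompacts.isOpen_subsets_of_isOpen (hU.union hV)).inter
      (NonemptyCompacts.isOpen_inter_nonempty_of_isOpen hU)).inter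
      (NonemptyCompacts.isOpen_inter_nonempty_of_isOpen hV)
  · obtain ⟨x, hx, hxu⟩ := not_subset.1 hKu
    obtain ⟨y, hy, hyv⟩ := not_subset.1 hKv
    exact ⟨⟨huv.trans (union_subset_union huU hvV), y, hy, huU ((huv hy).resolve_right hyv)⟩,
      x, hx, hvV ((huv hx).resolve_left hxu)⟩

theorem dense_setOf_not_isPreconnected {X : Type*} [TopologicalSpace X] [T1Space X]
    [PerfectSpace X] : Dense {K : NonemptyCompacts X | ¬ IsPreconnected (K : Set X)} := by
  refine dense_iff_inter_open.2 fun U hU hne => ?_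
  obtain ⟨K, hKU, hK⟩ := NonemptyCompacts.dense_setOfPred_finite.inter_open_nonempty U hU hne
  obtain ⟨x, hx⟩ := K.nonempty
  -- Adding to `K` a point `y ≠ x` close to `x ∈ K` keeps it finite and inside `U`, and a finite set
  -- with two points is disconnected.
  have hcont : Continuous fun y : X => K ⊔ ({y} : NonemptyCompacts X) :=
    continuous_const.sup NonemptyCompacts.continuous_singleton
  have hKx : K ⊔ ({x} : NonemptyCompacts X) = K :=
    sup_eq_left.2 (SetLike.coe_subset_coe.1 (by simpa using hx))
  have hev : ∀ᶠ y in 𝓝[≠] x, K ⊔ ({y} : NonemptyCompacts X) ∈ U :=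
    (hcont.continuousAt.eventually (hU.eventually_mem (by simpa only [hKx]))).filter_mono
      nhdsWithin_le_nhds
  obtain ⟨y, hyU, hyx⟩ := (hev.and self_mem_nhdsWithin).exists
  refine ⟨_, hyU, fun hpre => ?_⟩
  have hnt : ((K ⊔ ({y} : NonemptyCompacts X) : NonemptyCompacts X) : Set X).Nontrivial :=
    ⟨x, by simp [hx], y, by simp, Ne.symm hyx⟩
  refine hpre.infinite_of_nontrivial hnt ?_
  simpa using hK

end GenFractal

theorem mainTheorem7 (X : Type*) [MetricSpace X] [CompleteSpace X] [SeparableSpace X]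
    [PerfectSpace X] :
    ∀ᶠ K : NonemptyCompacts X in residual (NonemptyCompacts X),
      GenFractal.IsGeneralizedFractal K ∧
      ∀ r : ℝ, 0 < r → r < 1 →
        ∃ (n : ℕ) (f : Fin n → GenFractal.EllInfty K → X),
          GenFractal.Witnesses K f ∧ ∀ i, LipschitzWith r.toNNReal (f i) := by
  filter_upwards [residual_of_dense_open GenFractal.isOpen_setOf_not_isPreconnected
    GenFractal.dense_setOf_not_isPreconnected] with K hK
  refine ⟨?_, fun r hr₀ hr₁ => GenFractal.exists_witnesses_lipschitzWith K hK hr₀ hr₁⟩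
  obtain ⟨n, f, hf, -⟩ :=
    GenFractal.exists_witnesses_lipschitzWith K hK one_half_pos one_half_lt_one
  exact ⟨n, f, hf⟩
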